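/- All vector spaces are over $\mathbb{C}$. Let $V=\coprod_{n\in\mathbb Z}V_{(n)}$ be a vertex operator algebra (in the sense of Frenkel–Lepowsky–Meurman and Frenkel–Huang–Lepowsky), with $Y(u,z)=\sum_{n}u_nz^{-n-1}$, vacuum $\mathbf 1$ and conformal vector $\omega$, $L(n)=\omega_{n+1}$. A $V$-module is a space $W=\coprod_{\lambda\in\mathbb C}W_{\lambda}$, where $W_\lambda$ consists of vectors of $L(0)$-eigenvalue $\lambda$, $\dim W_\lambda<\infty$, and for each $\lambda$ one has $W_{\lambda+n}=0$ for all sufficiently negative integers $n$, with vertex operators $Y_W(u,z)=\sum_n u_nz^{-n-1}$ satisfying all the axioms of a vertex operator algebra that make sense. It is irreducible if $W\neq0$ and $0$, $W$ are its only submodules. *The algebra $U(V)$.* Let $A$ be the free associative unital algebra on $V\otimes\mathbb C[t,t^{-1}]$, write $u(n)=u\otimes t^n$, and grade $A=\coprod_{m\in\mathbb Z}A_m$ by giving $u(n)$ degree $p-n-1$ for $u\in V_{(p)}$. For $m,k\in\mathbb Z$ put $A_{m,k}=\sum_{n>k}A_{m+n}A_{-n}$. A sequence $(f_i)_{i\in\mathbb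 N}$ in $A_m$ is Cauchy if for every $k$ one has $f_i-f_j\in A_{m,k}$ for all sufficiently large $i,j$; two Cauchy sequences are equivalent if for every $k$ one has $f_i-g_i\in A_{m,k}$ for all sufficiently large $i$. Let $\tilde A_m$ be the space of equivalence classes of Cauchy sequences in $A_m$, and $\tilde A=\coprod_m\tilde A_m$, an algebra under termwise multiplication. Let $U(V)=\tilde A/\mathrm{Jac}$, where $\mathrm{Jac}$ is the two-sided ideal of $\tilde A$ generated by the relations $$\mathbf 1(n)=\delta_{n,-1},\qquad (L(-1)u)(n)=-n\,u(n-1),$$ $$\sum_{i\ge0}\binom li(-1)^iu(m+l-i)v(n+i)-\sum_{i\ge0}\binom li(-1)^{l+i}v(n+l-i)u(m+i)=\sum_{i\ge0}\binom mi(u_{l+i}v)(m+n-i)$$ for $u,v\in V$ and $l,m,n\in\mathbb Z$. *The algebra $gl_J$.* For $W=\coprod_{n\ge0}W(n)$ (with $W(n)=0$ for $n<0$), $gl_J(W)\subset\operatorname{End}W$ is the algebra of finite sums of homogeneous endomorphisms, where $f$ is homogeneous of degree $k\in\mathbb Z$ if $fW(n)\subset W(n+k)$ for all $n\in\mathbb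 Z$. **Theorem.** Let $V$ be a vertex operator algebra and $W$ an irreducible $V$-module. Then there is $h\in\mathbb C$ such that $W_h\ne0$ and all weights of $W$ lie in $h+\mathbb N$, so that $W=\coprod_{n\ge0}W(n)$ with $W(n)=W_{h+n}$ and $W(0)\neq 0$. There is a unique algebra homomorphism $\rho:U(V)\to\operatorname{End}W$ for which the class of a Cauchy sequence $(f_i)$ in $A_m$ ($m\in\mathbb Z$) acts on each $w\in W$ as the eventual value of $f_iw$, where $A$ acts on $W$ by letting $u(n)$ act as $u_n$. Its image lies in $gl_J(W)$, and $$\rho(U(V))=gl_J(W).$$ -/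

import Mathlib

open scoped TensorProduct LaurentPolynomial DirectSum
open Filter

noncomputable section

theorem iSup_mul_mem {B : Type*} [Ring B] [Algebra ℂ B] {P Q R : ℤ → Submodule ℂ B}
    (h : ∀ i j : ℤ, ∀ x ∈ P i, ∀ y ∈ Q j, x * y ∈ R (i + j)) {x y : B}
    (hx : x ∈ ⨆ i, P i) (hy : y ∈ ⨆ i, Q i) : x * y ∈ ⨆ i, R i := by
  induction hx using Submodule.iSup_induction' with
  | mem i x hx =>
    induction hy using Submodule.iSup_induction' with
    | mem j y hy => exact Submodule.mem_iSup_of_mem _ (h i j x hx y hy)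
    | zero => simp
    | add y z _ _ hy hz => rw [mul_add]; exact Submodule.add_mem _ hy hz
  | zero => simp
  | add x z _ _ hx hz => rw [add_mul]; exact Submodule.add_mem _ hx hz

/-! ## The algebra `gl_J(W)` -/

section GlJ

variable {W : Type*} [AddCommGroup W] [Module ℂ W]

/-- The endomorphisms of `W` that are homogeneous of degree `k` for the family of subspaces
`𝒲 n = W(n)`: those `f` with `f W(n) ⊆ W(n + k)` for all `n`. -/
def homogeneousEnd (𝒲 : ℤ → Submodule ℂ W) (k : ℤ) : Submodule ℂ (Module.End ℂ W) where
  carrier := {f | ∀ n : ℤ, ∀ w ∈ 𝒲 n, f w ∈ 𝒲 (n + k)}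
  add_mem' hf hg n w hw := (𝒲 (n + k)).add_mem (hf n w hw) (hg n w hw)
  zero_mem' n _ _ := (𝒲 (n + k)).zero_mem
  smul_mem' c _ hf n w hw := (𝒲 (n + k)).smul_mem c (hf n w hw)

theorem homogeneousEnd_mul_mem {𝒲 : ℤ → Submodule ℂ W} {j k : ℤ} {f g : Module.End ℂ W}
    (hf : f ∈ homogeneousEnd 𝒲 j) (hg : g ∈ homogeneousEnd 𝒲 k) :
    f * g ∈ homogeneousEnd 𝒲 (j + k) := by
  intro n w hw
  have h := hf _ _ (hg n w hw)
  rwa [show n + k + j = n + (j + k) by ring] at h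

/-- `gl_J(W)`: the subalgebra of `End W` of all finite sums of homogeneous endomorphisms. -/
def glJ (𝒲 : ℤ → Submodule ℂ W) : Subalgebra ℂ (Module.End ℂ W) :=
  (⨆ k : ℤ, homogeneousEnd 𝒲 k).toSubalgebra
    (Submodule.mem_iSup_of_mem 0 fun n w hw => by simpa using hw)
    (fun _ _ hx hy => iSup_mul_mem (fun _ _ _ hf _ hg => homogeneousEnd_mul_mem hf hg) hx hy)

end GlJ

/-! ## The completion of a `ℤ`-graded algebra -/

section Completion

variable {A : Type*} [Ring A] [Algebra ℂ A] (𝒜 : ℤ → Submodule ℂ A)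

/-- `A_{m,k} = ∑_{n > k} A_{m+n} A_{-n}`. -/
def gradedNhd (m k : ℤ) : Submodule ℂ A :=
  ⨆ n : ℤ, ⨆ _ : k < n, 𝒜 (m + n) * 𝒜 (-n)

/-- The space `C(A_m)` of Cauchy sequences in `A_m`. -/
def cauchySeqs (m : ℤ) : Submodule ℂ (ℕ → A) where
  carrier := {f | (∀ i, f i ∈ 𝒜 m) ∧
    ∀ k : ℤ, ∃ r : ℕ, ∀ i ≥ r, ∀ j ≥ r, f i - f j ∈ gradedNhd 𝒜 m k}
  add_mem' := by
    rintro f g ⟨hf, hf'⟩ ⟨hg, hg'⟩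
    refine ⟨fun i => add_mem (hf i) (hg i), fun k => ?_⟩
    obtain ⟨r, hr⟩ := hf' k
    obtain ⟨s, hs⟩ := hg' k
    refine ⟨max r s, fun i hi j hj => ?_⟩
    have := add_mem (hr i (le_of_max_le_left hi) j (le_of_max_le_left hj))
      (hs i (le_of_max_le_right hi) j (le_of_max_le_right hj))
    simpa only [Pi.add_apply, add_sub_add_comm] using this
  zero_mem' := ⟨fun _ => zero_mem _, fun _ => ⟨0, fun _ _ _ _ => by simp⟩⟩
  smul_mem' := by
    rintro c f ⟨hf, hf'⟩
    refine ⟨fun i => Submodule.smul_mem _ c (hf i), fun k => ?_⟩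
    obtain ⟨r, hr⟩ := hf' k
    refine ⟨r, fun i hi j hj => ?_⟩
    simpa only [Pi.smul_apply, smul_sub] using Submodule.smul_mem _ c (hr i hi j hj)

/-- The Cauchy sequences in `A_m` that are equivalent to `0`. -/
def nullSeqs (m : ℤ) : Submodule ℂ (ℕ → A) where
  carrier := {f | f ∈ cauchySeqs 𝒜 m ∧ ∀ k : ℤ, ∃ r : ℕ, ∀ i ≥ r, f i ∈ gradedNhd 𝒜 m k}
  add_mem' := by
    rintro f g ⟨hf, hf'⟩ ⟨hg, hg'⟩
    refine ⟨add_mem hf hg, fun k => ?_⟩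
    obtain ⟨r, hr⟩ := hf' k
    obtain ⟨s, hs⟩ := hg' k
    exact ⟨max r s, fun i hi =>
      add_mem (hr i (le_of_max_le_left hi)) (hs i (le_of_max_le_right hi))⟩
  zero_mem' := ⟨zero_mem _, fun _ => ⟨0, fun _ _ => zero_mem _⟩⟩
  smul_mem' := by
    rintro c f ⟨hf, hf'⟩
    refine ⟨Submodule.smul_mem _ c hf, fun k => ?_⟩
    obtain ⟨r, hr⟩ := hf' k
    exact ⟨r, fun i hi => Submodule.smul_mem _ c (hr i hi)⟩

variable {𝒜}

theorem mul_mem_gradedNhd [SetLike.GradedMonoid 𝒜] {m n k : ℤ} {a b : A} (ha : a ∈ 𝒜 m)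
    (hb : b ∈ gradedNhd 𝒜 n k) : a * b ∈ gradedNhd 𝒜 (m + n) k := by
  have key : gradedNhd 𝒜 n k ≤
      (gradedNhd 𝒜 (m + n) k).comap (LinearMap.mulLeft ℂ a) := by
    refine iSup₂_le fun j hj => Submodule.mul_le.2 fun x hx y hy => ?_
    simp only [Submodule.mem_comap, LinearMap.mulLeft_apply]
    rw [← mul_assoc]
    refine Submodule.mem_iSup_of_mem j (Submodule.mem_iSup_of_mem hj
      (Submodule.mul_mem_mul ?_ hy))
    rw [add_assoc]
    exact SetLike.mul_mem_graded ha hx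
  exact key hb

theorem gradedNhd_mul_mem [SetLike.GradedMonoid 𝒜] {m n k : ℤ} {a b : A}
    (ha : a ∈ gradedNhd 𝒜 m k) (hb : b ∈ 𝒜 n) : a * b ∈ gradedNhd 𝒜 (m + n) (k - n) := by
  have key : gradedNhd 𝒜 m k ≤
      (gradedNhd 𝒜 (m + n) (k - n)).comap (LinearMap.mulRight ℂ b) := by
    refine iSup₂_le fun j hj => Submodule.mul_le.2 fun x hx y hy => ?_
    simp only [Submodule.mem_comap, LinearMap.mulRight_apply]
    rw [mul_assoc]
    refine Submodule.mem_iSup_of_mem (j - n) (Submodule.mem_iSup_of_mem (by omega)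
      (Submodule.mul_mem_mul ?_ ?_))
    · rwa [show m + n + (j - n) = m + j by ring]
    · rw [show -(j - n) = -j + n by ring]
      exact SetLike.mul_mem_graded hy hb
  exact key ha

theorem cauchySeqs_mul_mem [SetLike.GradedMonoid 𝒜] {m n : ℤ} {f g : ℕ → A}
    (hf : f ∈ cauchySeqs 𝒜 m) (hg : g ∈ cauchySeqs 𝒜 n) : f * g ∈ cauchySeqs 𝒜 (m + n) := by
  refine ⟨fun i => SetLike.mul_mem_graded (hf.1 i) (hg.1 i), fun k => ?_⟩
  obtain ⟨r, hr⟩ := hf.2 (k + n)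
  obtain ⟨s, hs⟩ := hg.2 k
  refine ⟨max r s, fun i hi j hj => ?_⟩
  have h1 := gradedNhd_mul_mem (hr i (le_of_max_le_left hi) j (le_of_max_le_left hj)) (hg.1 i)
  rw [add_sub_cancel_right] at h1
  have h2 := mul_mem_gradedNhd (hf.1 j)
    (hs i (le_of_max_le_right hi) j (le_of_max_le_right hj))
  have h3 := add_mem h1 h2
  rwa [show (f i - f j) * g i + f j * (g i - g j) = (f * g) i - (f * g) j by
    simp only [Pi.mul_apply]; noncomm_ring] at h3

theorem mul_nullSeqs_mem [SetLike.GradedMonoid 𝒜] {m n : ℤ} {f g : ℕ → A}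
    (hf : f ∈ cauchySeqs 𝒜 m) (hg : g ∈ nullSeqs 𝒜 n) : f * g ∈ nullSeqs 𝒜 (m + n) := by
  refine ⟨cauchySeqs_mul_mem hf hg.1, fun k => ?_⟩
  obtain ⟨r, hr⟩ := hg.2 k
  exact ⟨r, fun i hi => mul_mem_gradedNhd (hf.1 i) (hr i hi)⟩

theorem nullSeqs_mul_mem [SetLike.GradedMonoid 𝒜] {m n : ℤ} {f g : ℕ → A}
    (hf : f ∈ nullSeqs 𝒜 m) (hg : g ∈ cauchySeqs 𝒜 n) : f * g ∈ nullSeqs 𝒜 (m + n) := by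
  refine ⟨cauchySeqs_mul_mem hf.1 hg, fun k => ?_⟩
  obtain ⟨r, hr⟩ := hf.2 (k + n)
  refine ⟨r, fun i hi => ?_⟩
  have h := gradedNhd_mul_mem (hr i hi) (hg.1 i)
  rwa [add_sub_cancel_right] at h

theorem const_mem_cauchySeqs {m : ℤ} {a : A} (ha : a ∈ 𝒜 m) :
    (fun _ => a : ℕ → A) ∈ cauchySeqs 𝒜 m :=
  ⟨fun _ => ha, fun _ => ⟨0, fun _ _ _ _ => by simp⟩⟩

variable (𝒜)

/-- The algebra `⨁_m C(A_m)` of finite sums of homogeneous Cauchy sequences, with termwise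
operations; the sum of the `C(A_m)` inside `ℕ → A` is direct because that of the `A_m` is. -/
def cauchyAlgebra [SetLike.GradedMonoid 𝒜] : Subalgebra ℂ (ℕ → A) :=
  (⨆ m : ℤ, cauchySeqs 𝒜 m).toSubalgebra
    (Submodule.mem_iSup_of_mem 0 (const_mem_cauchySeqs SetLike.GradedOne.one_mem))
    (fun _ _ hx hy => iSup_mul_mem (fun _ _ _ hf _ hg => cauchySeqs_mul_mem hf hg) hx hy)

/-- The two-sided ideal of finite sums of homogeneous Cauchy sequences equivalent to `0`. -/
def nullIdeal [SetLike.GradedMonoid 𝒜] : TwoSidedIdeal (cauchyAlgebra 𝒜) :=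
  TwoSidedIdeal.mk' {f | (f : ℕ → A) ∈ ⨆ m : ℤ, nullSeqs 𝒜 m}
    (show (0 : ℕ → A) ∈ ⨆ m : ℤ, nullSeqs 𝒜 m from Submodule.zero_mem _)
    (fun {x y} hx hy =>
      show (x : ℕ → A) + (y : ℕ → A) ∈ ⨆ m : ℤ, nullSeqs 𝒜 m from Submodule.add_mem _ hx hy)
    (fun {x} hx => show -(x : ℕ → A) ∈ ⨆ m : ℤ, nullSeqs 𝒜 m from Submodule.neg_mem _ hx)
    (fun {x _} hy => iSup_mul_mem (P := cauchySeqs 𝒜) (Q := nullSeqs 𝒜)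
      (R := nullSeqs 𝒜) (fun _ _ _ hf _ hg => mul_nullSeqs_mem hf hg) x.2 hy)
    (fun {_ y} hx => iSup_mul_mem (P := nullSeqs 𝒜) (Q := cauchySeqs 𝒜)
      (R := nullSeqs 𝒜) (fun _ _ _ hf _ hg => nullSeqs_mul_mem hf hg) hx y.2)

/-- The completion `Ã = ⨁_m C(A_m)/∼` of the graded algebra `A = ⨁_m A_m`. -/
abbrev GradedCompletion [SetLike.GradedMonoid 𝒜] : Type _ := (nullIdeal 𝒜).ringCon.Quotient

/-- The class in `Ã` of a sum of homogeneous Cauchy sequences. -/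
def GradedCompletion.mk [SetLike.GradedMonoid 𝒜] : cauchyAlgebra 𝒜 →ₐ[ℂ] GradedCompletion 𝒜 :=
  (nullIdeal 𝒜).ringCon.mkₐ (α := ℂ)

theorem const_mem_cauchyAlgebra [GradedAlgebra 𝒜] (a : A) :
    (fun _ => a : ℕ → A) ∈ cauchyAlgebra 𝒜 := by
  change (fun _ => a : ℕ → A) ∈ ⨆ m : ℤ, cauchySeqs 𝒜 m
  induction a using DirectSum.Decomposition.inductionOn 𝒜 with
  | zero => exact zero_mem _
  | homogeneous a => exact Submodule.mem_iSup_of_mem _ (const_mem_cauchySeqs a.2)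
  | add a b ha hb => exact add_mem ha hb

/-- The natural homomorphism `π : A → Ã` given by constant sequences. -/
def GradedCompletion.of [GradedAlgebra 𝒜] : A →ₐ[ℂ] GradedCompletion 𝒜 :=
  (GradedCompletion.mk 𝒜).comp
    ((Pi.constAlgHom ℂ ℕ A).codRestrict (cauchyAlgebra 𝒜) (const_mem_cauchyAlgebra 𝒜))

end Completion

/-! ## Vertex operator algebras and their modules -/

/-- The mode `u_n`, where `Y(u, z) = ∑_n u_n z^{-n-1}`. -/
def vertexMode {V W : Type*} [AddCommGroup V] [Module ℂ V] [AddCommGroup W] [Module ℂ W]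
    (Y : V →ₗ[ℂ] VertexOperator ℂ W) (u : V) (n : ℤ) : Module.End ℂ W :=
  VertexOperator.ncoeff (Y u) n

/-- The Jacobi identity in components, for a vertex operator map `Y` on `V` and a vertex operator
map `Y'` of `V` on `W`. All three sums have only finitely many nonzero terms. -/
def JacobiIdentity {V W : Type*} [AddCommGroup V] [Module ℂ V] [AddCommGroup W] [Module ℂ W]
    (Y : V →ₗ[ℂ] VertexOperator ℂ V) (Y' : V →ₗ[ℂ] VertexOperator ℂ W) : Prop :=
  ∀ (u v : V) (l m n : ℤ) (w : W),
    (∑ᶠ i : ℕ, ((i : ℤ).negOnePow * Ring.choose l i : ℤ) •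
        vertexMode Y' u (m + l - i) (vertexMode Y' v (n + i) w)) -
      (∑ᶠ i : ℕ, ((l + i).negOnePow * Ring.choose l i : ℤ) •
        vertexMode Y' v (n + l - i) (vertexMode Y' u (m + i) w)) =
    ∑ᶠ i : ℕ, Ring.choose m i • vertexMode Y' (vertexMode Y u (l + i) v) (m + n - i) w

/-- The Virasoro relations of central charge `c` for the operators `L(n)`. -/
def VirasoroRelations {W : Type*} [AddCommGroup W] [Module ℂ W]
    (L : ℤ → Module.End ℂ W) (c : ℂ) : Prop :=
  ∀ m n : ℤ, L m * L n - L n * L m =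
    ((m - n : ℤ) : ℂ) • L (m + n) +
      (if m + n = 0 then ((m ^ 3 - m : ℤ) : ℂ) / 12 * c else 0) • (1 : Module.End ℂ W)

/-- A vertex operator algebra structure on the complex vector space `V`. That `Y(u, z) v` has only
finitely many negative powers of `z` is part of the type `VertexOperator ℂ V`. -/
structure VertexOperatorAlgebra (V : Type*) [AddCommGroup V] [Module ℂ V] where
  /-- The vertex operator map `u ↦ Y(u, z)`. -/
  Y : V →ₗ[ℂ] VertexOperator ℂ V
  /-- The vacuum vector. -/
  vac : V
  /-- The conformal (Virasoro) vector. -/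
  conf : V
  /-- The rank (central charge). -/
  rank : ℂ
  /-- The homogeneous subspace of weight `n`. -/
  wt : ℤ → Submodule ℂ V
  isInternal_wt : DirectSum.IsInternal wt
  finiteDimensional_wt : ∀ n, FiniteDimensional ℂ (wt n)
  wt_eq_bot : ∃ N : ℤ, ∀ n < N, wt n = ⊥
  vac_mem : vac ∈ wt 0
  conf_mem : conf ∈ wt 2
  vertexMode_vac : ∀ n : ℤ, vertexMode Y vac n = if n = -1 then 1 else 0
  creation_nonneg : ∀ (v : V) (n : ℤ), 0 ≤ n → vertexMode Y v n vac = 0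
  creation : ∀ v : V, vertexMode Y v (-1) vac = v
  jacobi : JacobiIdentity Y Y
  virasoro : VirasoroRelations (fun n => vertexMode Y conf (n + 1)) rank
  /-- `L(0) v = n v` for `v` of weight `n`, where `L(0) = ω_1`. -/
  weight : ∀ (n : ℤ), ∀ v ∈ wt n, vertexMode Y conf 1 v = (n : ℂ) • v
  /-- `Y(L(-1) v, z) = d/dz Y(v, z)`, where `L(-1) = ω_0`. -/
  derivative : ∀ (v : V) (n : ℤ),
    vertexMode Y (vertexMode Y conf 0 v) n = (-n : ℂ) • vertexMode Y v (n - 1)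

/-- A module structure on the complex vector space `W` over a vertex operator algebra. -/
structure VertexOperatorAlgebra.Mod {V : Type*} [AddCommGroup V] [Module ℂ V]
    (𝒱 : VertexOperatorAlgebra V) (W : Type*) [AddCommGroup W] [Module ℂ W] where
  /-- The vertex operator map `u ↦ Y_W(u, z)`. -/
  Y : V →ₗ[ℂ] VertexOperator ℂ W
  /-- The homogeneous subspace of weight `h`. -/
  wt : ℂ → Submodule ℂ W
  isInternal_wt : DirectSum.IsInternal wt
  finiteDimensional_wt : ∀ h, FiniteDimensional ℂ (wt h)
  wt_eq_bot : ∀ h : ℂ, ∃ N : ℤ, ∀ n < N, wt (h + n) = ⊥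
  vertexMode_vac : ∀ n : ℤ, vertexMode Y 𝒱.vac n = if n = -1 then 1 else 0
  jacobi : JacobiIdentity 𝒱.Y Y
  virasoro : VirasoroRelations (fun n => vertexMode Y 𝒱.conf (n + 1)) 𝒱.rank
  weight : ∀ (h : ℂ), ∀ w ∈ wt h, vertexMode Y 𝒱.conf 1 w = h • w
  derivative : ∀ (v : V) (n : ℤ),
    vertexMode Y (vertexMode 𝒱.Y 𝒱.conf 0 v) n = (-n : ℂ) • vertexMode Y v (n - 1)

namespace VertexOperatorAlgebra

/-- Irreducibility: `W` is nonzero and has no submodules other than `0` and `W`. -/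
def Mod.IsIrreducible {V W : Type*} [AddCommGroup V] [Module ℂ V] [AddCommGroup W] [Module ℂ W]
    {𝒱 : VertexOperatorAlgebra V} (M : 𝒱.Mod W) : Prop :=
  Nontrivial W ∧ ∀ U : Submodule ℂ W,
    (∀ (v : V) (n : ℤ), ∀ w ∈ U, vertexMode M.Y v n w ∈ U) → U = ⊥ ∨ U = ⊤

/-- `h` is the lowest weight of `W`: `W_h ≠ 0`, and all weights of `W` lie in `h + ℕ`. -/
def Mod.IsLowestWeight {V W : Type*} [AddCommGroup V] [Module ℂ V] [AddCommGroup W] [Module ℂ W]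
    {𝒱 : VertexOperatorAlgebra V} (M : 𝒱.Mod W) (h : ℂ) : Prop :=
  M.wt h ≠ ⊥ ∧ ∀ μ : ℂ, M.wt μ ≠ ⊥ → ∃ n : ℕ, μ = h + n

/-! ### The free algebra on `V ⊗ ℂ[t, t⁻¹]` -/

/-- The linear map `V ⊗ ℂ[t, t⁻¹] → N` with `v ⊗ t^n ↦ g n v`. -/
def laurentLift {V N : Type*} [AddCommGroup V] [Module ℂ V] [AddCommMonoid N] [Module ℂ N]
    (g : ℤ → V →ₗ[ℂ] N) : V ⊗[ℂ] ℂ[T;T⁻¹] →ₗ[ℂ] N :=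
  TensorProduct.lift (LinearMap.flip
    ((Finsupp.lsum ℂ fun n => LinearMap.toSpanSingleton ℂ (V →ₗ[ℂ] N) (g n)) ∘ₗ
      (AddMonoidAlgebra.coeffLinearEquiv ℂ).toLinearMap))

theorem laurentLift_tmul_T {V N : Type*} [AddCommGroup V] [Module ℂ V] [AddCommMonoid N]
    [Module ℂ N] (g : ℤ → V →ₗ[ℂ] N) (v : V) (n : ℤ) :
    laurentLift g (v ⊗ₜ[ℂ] LaurentPolynomial.T n) = g n v := by
  have h : AddMonoidAlgebra.coeffLinearEquiv ℂ (LaurentPolynomial.T n : ℂ[T;T⁻¹]) =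
      Finsupp.single n 1 := rfl
  simp only [laurentLift, TensorProduct.lift.tmul, LinearMap.flip_apply, LinearMap.comp_apply,
    LinearEquiv.coe_coe, h]
  simp

/-- The free associative unital algebra on `V ⊗ ℂ[t, t⁻¹]`. -/
abbrev ModeAlgebra (V : Type*) [AddCommGroup V] [Module ℂ V] : Type _ :=
  TensorAlgebra ℂ (V ⊗[ℂ] ℂ[T;T⁻¹])

/-- The generator `v(n) = v ⊗ t^n`. -/
def gen {V : Type*} [AddCommGroup V] [Module ℂ V] (v : V) (n : ℤ) : ModeAlgebra V :=
  TensorAlgebra.ι ℂ (v ⊗ₜ[ℂ] LaurentPolynomial.T n)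

/-- The products of generators `v(n)` with `v` homogeneous, with their degrees:
`v(n)` has degree `wt v - n - 1`. -/
inductive IsMonomial {V : Type*} [AddCommGroup V] [Module ℂ V] (𝒱 : VertexOperatorAlgebra V) :
    ℤ → ModeAlgebra V → Prop
  | one : IsMonomial 𝒱 0 1
  | gen_mul {p d : ℤ} {v : V} {x : ModeAlgebra V} (n : ℤ) (hv : v ∈ 𝒱.wt p)
      (hx : IsMonomial 𝒱 d x) : IsMonomial 𝒱 (p - n - 1 + d) (gen v n * x)

/-- The homogeneous subspace of degree `m` of the free algebra. -/
def modeGrading {V : Type*} [AddCommGroup V] [Module ℂ V] (𝒱 : VertexOperatorAlgebra V) (m : ℤ) :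
    Submodule ℂ (ModeAlgebra V) :=
  Submodule.span ℂ {x | 𝒱.IsMonomial m x}

section

variable {V : Type*} [AddCommGroup V] [Module ℂ V] (𝒱 : VertexOperatorAlgebra V)

theorem IsMonomial.mul {d e : ℤ} {x y : ModeAlgebra V} (hx : 𝒱.IsMonomial d x)
    (hy : 𝒱.IsMonomial e y) : 𝒱.IsMonomial (d + e) (x * y) := by
  induction hx with
  | one => simpa using hy
  | gen_mul n hv _ ih =>
    rw [mul_assoc, add_assoc]
    exact IsMonomial.gen_mul n hv ih

theorem gen_mem_modeGrading {p : ℤ} {v : V} (hv : v ∈ 𝒱.wt p) (n : ℤ) :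
    gen v n ∈ 𝒱.modeGrading (p - n - 1) := by
  have h := IsMonomial.gen_mul n hv (IsMonomial.one (𝒱 := 𝒱))
  rw [mul_one, add_zero] at h
  exact Submodule.subset_span h

instance gradedMonoid_modeGrading : SetLike.GradedMonoid 𝒱.modeGrading where
  one_mem := Submodule.subset_span IsMonomial.one
  mul_mem := by
    intro i j a b ha hb
    have h : 𝒱.modeGrading i * 𝒱.modeGrading j ≤ 𝒱.modeGrading (i + j) := by
      rw [modeGrading, modeGrading, Submodule.span_mul_span]
      refine Submodule.span_mono ?_
      rintro _ ⟨x, hx, y, hy, rfl⟩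
      exact IsMonomial.mul 𝒱 hx hy
    exact h (Submodule.mul_mem_mul ha hb)

/-- The linear map from `V ⊗ t^n` to the graded free algebra. -/
def gradedGen (n : ℤ) : V →ₗ[ℂ] ⨁ m : ℤ, 𝒱.modeGrading m :=
  letI := 𝒱.isInternal_wt.chooseDecomposition
  (DirectSum.toModule ℂ ℤ _ fun p =>
      DirectSum.lof ℂ ℤ (fun m => 𝒱.modeGrading m) (p - n - 1) ∘ₗ
        ((TensorAlgebra.ι ℂ ∘ₗ
          (TensorProduct.mk ℂ V ℂ[T;T⁻¹]).flip (LaurentPolynomial.T n)) ∘ₗ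
            (𝒱.wt p).subtype).codRestrict _ fun v => 𝒱.gen_mem_modeGrading v.2 n) ∘ₗ
    (DirectSum.decomposeLinearEquiv 𝒱.wt).toLinearMap

theorem gradedGen_of_mem {p : ℤ} {v : V} (hv : v ∈ 𝒱.wt p) (n : ℤ) :
    𝒱.gradedGen n v =
      DirectSum.of (fun m => 𝒱.modeGrading m) (p - n - 1) ⟨_, 𝒱.gen_mem_modeGrading hv n⟩ := by
  let _ := 𝒱.isInternal_wt.chooseDecomposition
  have h : DirectSum.decomposeLinearEquiv 𝒱.wt v =
      DirectSum.lof ℂ ℤ (fun p => 𝒱.wt p) p ⟨v, hv⟩ := DirectSum.decompose_of_mem 𝒱.wt hv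
  rw [gradedGen, LinearMap.comp_apply, LinearEquiv.coe_coe, h, DirectSum.toModule_lof]
  rfl

instance gradedAlgebra_modeGrading : GradedAlgebra 𝒱.modeGrading :=
  GradedAlgebra.ofAlgHom _ (TensorAlgebra.lift ℂ (laurentLift 𝒱.gradedGen))
    (by
      refine TensorAlgebra.hom_ext (TensorProduct.ext' fun v p => ?_)
      induction p using LaurentPolynomial.induction_on' with
      | add p q hp hq => rw [TensorProduct.tmul_add, map_add, map_add, hp, hq]
      | C_mul_T n a =>
        rw [← LaurentPolynomial.smul_eq_C_mul, TensorProduct.tmul_smul, map_smul, map_smul]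
        congr 1
        have hv : v ∈ ⨆ p, 𝒱.wt p := by
          rw [𝒱.isInternal_wt.submodule_iSup_eq_top]
          trivial
        simp only [LinearMap.comp_apply, AlgHom.toLinearMap_apply, AlgHom.comp_apply,
          AlgHom.id_apply, TensorAlgebra.lift_ι_apply, laurentLift_tmul_T]
        induction hv using Submodule.iSup_induction' with
        | mem p v hv =>
          rw [gradedGen_of_mem 𝒱 hv, DirectSum.coeAlgHom_of]
          rfl
        | zero => simp
        | add x y _ _ hx hy => rw [map_add, map_add, hx, hy, TensorProduct.add_tmul, map_add])
    (by
      rintro i ⟨x, hx⟩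
      induction hx using Submodule.span_induction with
      | mem x hx =>
        dsimp only
        induction hx with
        | one => rw [map_one]; rfl
        | gen_mul n hv hx ih =>
          rename_i v _
          have h : TensorAlgebra.lift ℂ (laurentLift 𝒱.gradedGen) (gen v n) =
              𝒱.gradedGen n v :=
            (TensorAlgebra.lift_ι_apply _ _).trans (laurentLift_tmul_T _ v n)
          rw [map_mul, ih, h, gradedGen_of_mem 𝒱 hv, DirectSum.of_mul_of]
          rfl
      | zero => rw [map_zero]; exact (map_zero (DirectSum.lof ℂ ℤ _ i)).symm
      | add x y hx hy ihx ihy =>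
        dsimp only at ihx ihy ⊢
        rw [map_add, ihx, ihy, ← map_add]
        rfl
      | smul a x hx ih =>
        dsimp only at ih ⊢
        rw [map_smul, ih]
        exact ((DirectSum.lof ℂ ℤ (fun m => 𝒱.modeGrading m) i).map_smul a ⟨x, hx⟩).symm)

/-- The sequence of partial sums of the series `∑_{i ≥ 0} c_i u(a - i) v(b + i)`. -/
def modeSeries (c : ℕ → ℤ) (u v : V) (a b : ℤ) (N : ℕ) : ModeAlgebra V :=
  ∑ i ∈ Finset.range N, c i • (gen u (a - i) * gen v (b + i))

theorem modeSeries_mem_cauchySeqs (c : ℕ → ℤ) {p q : ℤ} {u v : V} (hu : u ∈ 𝒱.wt p)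
    (hv : v ∈ 𝒱.wt q) (a b : ℤ) :
    modeSeries c u v a b ∈ cauchySeqs 𝒱.modeGrading (p + q - a - b - 2) := by
  have hterm : ∀ i : ℕ, c i • (gen u (a - i) * gen v (b + i)) ∈
      𝒱.modeGrading (p + q - a - b - 2) := by
    intro i
    have h := SetLike.mul_mem_graded (𝒱.gen_mem_modeGrading hu (a - i))
      (𝒱.gen_mem_modeGrading hv (b + i))
    rw [show p - (a - i) - 1 + (q - (b + i) - 1) = p + q - a - b - 2 by ring] at h
    exact zsmul_mem h _
  have htail : ∀ k : ℤ, ∃ r : ℕ, ∀ i ≥ r, c i • (gen u (a - i) * gen v (b + i)) ∈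
      gradedNhd 𝒱.modeGrading (p + q - a - b - 2) k := by
    intro k
    refine ⟨(k + q - b).toNat, fun i hi => zsmul_mem ?_ _⟩
    refine Submodule.mem_iSup_of_mem (b + i + 1 - q)
      (Submodule.mem_iSup_of_mem (by omega) (Submodule.mul_mem_mul ?_ ?_))
    · rw [show p + q - a - b - 2 + (b + i + 1 - q) = p - (a - i) - 1 by ring]
      exact 𝒱.gen_mem_modeGrading hu _
    · rw [show -(b + i + 1 - q) = q - (b + i) - 1 by ring]
      exact 𝒱.gen_mem_modeGrading hv _
  refine ⟨fun N => Submodule.sum_mem _ fun i _ => hterm i, fun k => ?_⟩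
  obtain ⟨r, hr⟩ := htail k
  have key : ∀ i ≥ r, modeSeries c u v a b i - modeSeries c u v a b r ∈
      gradedNhd 𝒱.modeGrading (p + q - a - b - 2) k := by
    intro i hi
    rw [modeSeries, modeSeries, ← Finset.sum_Ico_eq_sub _ hi]
    exact Submodule.sum_mem _ fun j hj => hr j (Finset.mem_Ico.1 hj).1
  refine ⟨r, fun i hi j hj => ?_⟩
  have h := Submodule.sub_mem _ (key i hi) (key j hj)
  rwa [sub_sub_sub_cancel_right] at h

theorem modeSeries_mem (c : ℕ → ℤ) (u v : V) (a b : ℤ) :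
    modeSeries c u v a b ∈ cauchyAlgebra 𝒱.modeGrading := by
  change modeSeries c u v a b ∈ ⨆ m : ℤ, cauchySeqs 𝒱.modeGrading m
  have hu : u ∈ ⨆ p, 𝒱.wt p := by
    rw [𝒱.isInternal_wt.submodule_iSup_eq_top]
    trivial
  have hv : v ∈ ⨆ p, 𝒱.wt p := by
    rw [𝒱.isInternal_wt.submodule_iSup_eq_top]
    trivial
  induction hu using Submodule.iSup_induction' with
  | mem p u hu =>
    induction hv using Submodule.iSup_induction' with
    | mem q v hv => exact Submodule.mem_iSup_of_mem _ (𝒱.modeSeries_mem_cauchySeqs c hu hv a b)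
    | zero =>
      have h : modeSeries c u (0 : V) a b = 0 := by
        funext N
        simp [modeSeries, gen]
      rw [h]
      exact Submodule.zero_mem _
    | add x y _ _ hx hy =>
      have h : modeSeries c u (x + y) a b = modeSeries c u x a b + modeSeries c u y a b := by
        funext N
        simp [modeSeries, gen, TensorProduct.add_tmul, mul_add, Finset.sum_add_distrib]
      rw [h]
      exact Submodule.add_mem _ hx hy
  | zero =>
    have h : modeSeries c (0 : V) v a b = 0 := by
      funext N
      simp [modeSeries, gen]
    rw [h]
    exact Submodule.zero_mem _
  | add x y _ _ hx hy =>
    have h : modeSeries c (x + y) v a b = modeSeries c x v a b + modeSeries c y v a b := by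
      funext N
      simp [modeSeries, gen, TensorProduct.add_tmul, add_mul, Finset.sum_add_distrib]
    rw [h]
    exact Submodule.add_mem _ hx hy

/-- The element `∑_{i ≥ 0} c_i u(a - i) v(b + i)` of the completed free algebra. -/
def modeSum (c : ℕ → ℤ) (u v : V) (a b : ℤ) : GradedCompletion 𝒱.modeGrading :=
  GradedCompletion.mk 𝒱.modeGrading ⟨modeSeries c u v a b, 𝒱.modeSeries_mem c u v a b⟩

/-- The generator `v(n)` in the completed free algebra. -/
def cgen (v : V) (n : ℤ) : GradedCompletion 𝒱.modeGrading :=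
  GradedCompletion.of 𝒱.modeGrading (gen v n)

/-- The elements of the completed free algebra that are set to zero in `U(V)`. -/
inductive JacRelator : GradedCompletion 𝒱.modeGrading → Prop
  | vac (n : ℤ) : JacRelator (𝒱.cgen 𝒱.vac n - if n = -1 then 1 else 0)
  | derivative (u : V) (n : ℤ) :
      JacRelator (𝒱.cgen (vertexMode 𝒱.Y 𝒱.conf 0 u) n - (-n : ℂ) • 𝒱.cgen u (n - 1))
  | jacobi (u v : V) (l m n : ℤ) :
      JacRelator
        (𝒱.modeSum (fun i => (i : ℤ).negOnePow * Ring.choose l i) u v (m + l) n -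
          𝒱.modeSum (fun i => (l + i).negOnePow * Ring.choose l i) v u (n + l) m -
          ∑ᶠ i : ℕ, Ring.choose m i • 𝒱.cgen (vertexMode 𝒱.Y u (l + i) v) (m + n - i))

/-- The two-sided ideal `Jac` of the completed free algebra. -/
def jacIdeal : TwoSidedIdeal (GradedCompletion 𝒱.modeGrading) :=
  TwoSidedIdeal.span {x | 𝒱.JacRelator x}

/-- The Frenkel–Zhu universal enveloping algebra `U(V)`. -/
abbrev UnivEnv : Type _ := 𝒱.jacIdeal.ringCon.Quotient

/-- The class in `U(V)` of a sum of homogeneous Cauchy sequences in the free algebra. -/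
def UnivEnv.mk : cauchyAlgebra 𝒱.modeGrading →ₐ[ℂ] 𝒱.UnivEnv :=
  (𝒱.jacIdeal.ringCon.mkₐ (α := ℂ)).comp (GradedCompletion.mk 𝒱.modeGrading)

variable {𝒱} {W : Type*} [AddCommGroup W] [Module ℂ W]

/-- The action of the free algebra on a `V`-module: `v(n)` acts as `v_n`. -/
def Mod.freeAction (M : 𝒱.Mod W) : ModeAlgebra V →ₐ[ℂ] Module.End ℂ W :=
  TensorAlgebra.lift ℂ (laurentLift fun n =>
    LinearMap.proj n ∘ₗ VertexOperator.ncoeff ∘ₗ M.Y)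

theorem Mod.freeAction_gen (M : 𝒱.Mod W) (v : V) (n : ℤ) :
    M.freeAction (gen v n) = vertexMode M.Y v n := by
  simp [Mod.freeAction, gen, laurentLift_tmul_T, vertexMode]

/-- The family of homogeneous subspaces `W(n) = W_{h + n}`. -/
def Mod.shiftedWt (M : 𝒱.Mod W) (h : ℂ) (n : ℤ) : Submodule ℂ W := M.wt (h + n)

/-- `ρ` is the natural action of `U(V)` on the `V`-module `W`: the class of `(f_i)` acts on
`w` as the eventual value of `f_i w`. -/
def Mod.IsNaturalAction (M : 𝒱.Mod W) (ρ : 𝒱.UnivEnv →ₐ[ℂ] Module.End ℂ W) : Prop :=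
  ∀ (f : cauchyAlgebra 𝒱.modeGrading) (w : W),
    ∀ᶠ i in atTop, ρ (UnivEnv.mk 𝒱 f) w = M.freeAction (f.1 i) w

end

end VertexOperatorAlgebra

end

/-!
The weights of an irreducible module `W` lie in one coset `μ + ℤ`, because the weight spaces of a
coset span a submodule (`Mod.vertexMode_mem_wt`), and within the coset they are bounded below; this
gives the lowest weight `h` (`Mod.exists_isLowestWeight`) and the grading `W(n) = W_{h + n}`.

For `n > j` the factor `A_{-n}` kills `W(j)`, so `A_{m,k}` kills `W(j)` as soon as `k ≥ j`. Hence a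
Cauchy sequence is eventually constant on each vector, and a null sequence is eventually zero. The
eventual values define an action of the completion `Ã` by elements of `gl_J(W)`
(`completionAction`); it kills the relators of `Jac` because a module satisfies the corresponding
identities (`Mod.IsLowestWeight.completedAction_eq_zero`). Uniqueness is immediate, as every
element of `U(V)` is the class of some sum of Cauchy sequences.

For surjectivity, the free algebra acts irreducibly on `W`, and its commutant consists of scalars
since it preserves the finite-dimensional eigenspace `W_h` of `L(0)`. By the Jacobson density
theorem the free algebra acts densely, and taking homogeneous components, any map `W(n) → W(n + m)`
on finitely many vectors is realized by `A_m` (`exists_mem_forall_apply_eq`). An arbitrary sequence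
of approximations to a given endomorphism need not be Cauchy. However, since `W(0) ≠ 0`, every
linear map `W(n) → W(n + m)` is a sum of composites through `W(0)`, so it is realized even by
`A_{m + n} A_{-n}` (`exists_mem_mul_forall_apply_eq`). Correcting the approximation on
`W(0), W(1), …` in turn by such elements leaves the earlier spaces untouched and yields a Cauchy
sequence (`exists_mem_cauchySeqs_eventually_eq`).
-/

noncomputable section

/-! ### The action of the completed algebra -/

section GradedAction

variable {A : Type*} [Ring A] [Algebra ℂ A] {𝒜 : ℤ → Submodule ℂ A}
  {W : Type*} [AddCommGroup W] [Module ℂ W] {𝒲 : ℤ → Submodule ℂ W}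
  {τ : A →ₐ[ℂ] Module.End ℂ W}

/-- For `n > k` the factor `A_{-n}` sends `W(j)` to `W(j - n)`, which vanishes once `j ≤ k`. -/
theorem apply_eq_zero_of_mem_gradedNhd (hneg : ∀ n < 0, 𝒲 n = ⊥)
    (hτ : ∀ m, ∀ a ∈ 𝒜 m, τ a ∈ homogeneousEnd 𝒲 m) {m k j : ℤ} {x : A}
    (hx : x ∈ gradedNhd 𝒜 m k) {w : W} (hw : w ∈ 𝒲 j) (hjk : j ≤ k) : τ x w = 0 := by
  have key : gradedNhd 𝒜 m k ≤
      LinearMap.ker ((LinearMap.applyₗ w) ∘ₗ τ.toLinearMap) := by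
    refine iSup₂_le fun n hn => Submodule.mul_le.2 fun a _ b hb => ?_
    have h := hτ _ b hb j w hw
    rw [hneg _ (by omega), Submodule.mem_bot] at h
    simp [h]
  simpa using key hx

theorem eventually_apply_eq_of_mem_cauchySeqs (htop : ⨆ n, 𝒲 n = ⊤) (hneg : ∀ n < 0, 𝒲 n = ⊥)
    (hτ : ∀ m, ∀ a ∈ 𝒜 m, τ a ∈ homogeneousEnd 𝒲 m) {m : ℤ} {f : ℕ → A}
    (hf : f ∈ cauchySeqs 𝒜 m) (w : W) : ∃ v, ∀ᶠ i in atTop, τ (f i) w = v := by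
  have hw : w ∈ ⨆ n, 𝒲 n := htop ▸ Submodule.mem_top
  induction hw using Submodule.iSup_induction' with
  | mem j w hw =>
    obtain ⟨r, hr⟩ := hf.2 j
    refine ⟨τ (f r) w, eventually_atTop.2 ⟨r, fun i hi => ?_⟩⟩
    have h := apply_eq_zero_of_mem_gradedNhd hneg hτ (hr i hi r le_rfl) hw le_rfl
    rwa [map_sub, LinearMap.sub_apply, sub_eq_zero] at h
  | zero => exact ⟨0, by simp⟩
  | add x y _ _ hx hy =>
    obtain ⟨v, hv⟩ := hx
    obtain ⟨v', hv'⟩ := hy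
    exact ⟨v + v', by filter_upwards [hv, hv'] with i h h'; rw [map_add, h, h']⟩

/-- A sum of homogeneous Cauchy sequences converges pointwise, on every vector of `W` in finitely
many steps, to an element of `gl_J(W)`. -/
theorem exists_mem_glJ_eventually_apply_eq (htop : ⨆ n, 𝒲 n = ⊤) (hneg : ∀ n < 0, 𝒲 n = ⊥)
    (hτ : ∀ m, ∀ a ∈ 𝒜 m, τ a ∈ homogeneousEnd 𝒲 m) {f : ℕ → A}
    (hf : f ∈ ⨆ m, cauchySeqs 𝒜 m) : ∃ g ∈ glJ 𝒲, ∀ w, ∀ᶠ i in atTop, g w = τ (f i) w := by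
  induction hf using Submodule.iSup_induction' with
  | mem m f hf =>
    choose g hg using eventually_apply_eq_of_mem_cauchySeqs htop hneg hτ hf
    refine ⟨{ toFun := g, map_add' := fun x y => ?_, map_smul' := fun c x => ?_ },
      Submodule.mem_iSup_of_mem m fun n w hw => ?_, fun w => (hg w).mono fun i hi => hi.symm⟩
    · obtain ⟨i, h₁, h₂, h₃⟩ := ((hg (x + y)).and ((hg x).and (hg y))).exists
      rw [← h₁, ← h₂, ← h₃, map_add]
    · obtain ⟨i, h₁, h₂⟩ := ((hg (c • x)).and (hg x)).exists
      rw [← h₁, ← h₂, map_smul, RingHom.id_apply]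
    · obtain ⟨i, hi⟩ := (hg w).exists
      exact (hi ▸ hτ m _ (hf.1 i) n w hw : g w ∈ 𝒲 (n + m))
  | zero => exact ⟨0, zero_mem _, by simp⟩
  | add f f' _ _ hf hf' =>
    obtain ⟨g, hg, h⟩ := hf
    obtain ⟨g', hg', h'⟩ := hf'
    refine ⟨g + g', add_mem hg hg', fun w => ?_⟩
    filter_upwards [h w, h' w] with i hi hi'
    rw [LinearMap.add_apply, hi, hi', Pi.add_apply, map_add, LinearMap.add_apply]

theorem eventually_apply_eq_zero_of_mem_nullSeqs (htop : ⨆ n, 𝒲 n = ⊤)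
    (hneg : ∀ n < 0, 𝒲 n = ⊥) (hτ : ∀ m, ∀ a ∈ 𝒜 m, τ a ∈ homogeneousEnd 𝒲 m) {f : ℕ → A}
    (hf : f ∈ ⨆ m, nullSeqs 𝒜 m) (w : W) : ∀ᶠ i in atTop, τ (f i) w = 0 := by
  induction hf using Submodule.iSup_induction' with
  | mem m f hf =>
    have hw : w ∈ ⨆ n, 𝒲 n := htop ▸ Submodule.mem_top
    induction hw using Submodule.iSup_induction' with
    | mem j w hw =>
      obtain ⟨r, hr⟩ := hf.2 j
      exact eventually_atTop.2
        ⟨r, fun i hi => apply_eq_zero_of_mem_gradedNhd hneg hτ (hr i hi) hw le_rfl⟩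
    | zero => simp
    | add x y _ _ hx hy => filter_upwards [hx, hy] with i h h'; rw [map_add, h, h', add_zero]
  | zero => simp
  | add f f' _ _ hf hf' =>
    filter_upwards [hf, hf'] with i h h'
    rw [Pi.add_apply, map_add, LinearMap.add_apply, h, h', add_zero]

/-- The pointwise eventual value on `W` of a sum of homogeneous Cauchy sequences. -/
def eventualEnd [SetLike.GradedMonoid 𝒜] (htop : ⨆ n, 𝒲 n = ⊤) (hneg : ∀ n < 0, 𝒲 n = ⊥)
    (hτ : ∀ m, ∀ a ∈ 𝒜 m, τ a ∈ homogeneousEnd 𝒲 m) (f : cauchyAlgebra 𝒜) : glJ 𝒲 :=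
  have h := exists_mem_glJ_eventually_apply_eq htop hneg hτ f.2
  ⟨h.choose, h.choose_spec.1⟩

theorem eventually_eventualEnd_apply_eq [SetLike.GradedMonoid 𝒜] (htop : ⨆ n, 𝒲 n = ⊤)
    (hneg : ∀ n < 0, 𝒲 n = ⊥) (hτ : ∀ m, ∀ a ∈ 𝒜 m, τ a ∈ homogeneousEnd 𝒲 m)
    (f : cauchyAlgebra 𝒜) (w : W) :
    ∀ᶠ i in atTop, (eventualEnd htop hneg hτ f).1 w = τ (f.1 i) w :=
  (exists_mem_glJ_eventually_apply_eq htop hneg hτ f.2).choose_spec.2 w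

theorem eventualEnd_eq_of_eventually_eq [SetLike.GradedMonoid 𝒜] (htop : ⨆ n, 𝒲 n = ⊤)
    (hneg : ∀ n < 0, 𝒲 n = ⊥) (hτ : ∀ m, ∀ a ∈ 𝒜 m, τ a ∈ homogeneousEnd 𝒲 m)
    {f : cauchyAlgebra 𝒜} {g : glJ 𝒲} (h : ∀ w, ∀ᶠ i in atTop, g.1 w = τ (f.1 i) w) :
    eventualEnd htop hneg hτ f = g := by
  refine Subtype.ext (LinearMap.ext fun w => ?_)
  obtain ⟨i, h₁, h₂⟩ := ((eventually_eventualEnd_apply_eq htop hneg hτ f w).and (h w)).exists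
  exact h₁.trans h₂.symm

/-- The action on `W` of the algebra of sums of homogeneous Cauchy sequences, by pointwise
eventual values. -/
def cauchyAction [SetLike.GradedMonoid 𝒜] (htop : ⨆ n, 𝒲 n = ⊤) (hneg : ∀ n < 0, 𝒲 n = ⊥)
    (hτ : ∀ m, ∀ a ∈ 𝒜 m, τ a ∈ homogeneousEnd 𝒲 m) : cauchyAlgebra 𝒜 →ₐ[ℂ] glJ 𝒲 :=
  AlgHom.ofLinearMap
    { toFun := eventualEnd htop hneg hτ
      map_add' := fun f f' => eventualEnd_eq_of_eventually_eq htop hneg hτ fun w => by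
        filter_upwards [eventually_eventualEnd_apply_eq htop hneg hτ f w,
          eventually_eventualEnd_apply_eq htop hneg hτ f' w] with i h h'
        simp [h, h']
      map_smul' := fun c f => eventualEnd_eq_of_eventually_eq htop hneg hτ fun w => by
        filter_upwards [eventually_eventualEnd_apply_eq htop hneg hτ f w] with i h
        simp [h] }
    (eventualEnd_eq_of_eventually_eq htop hneg hτ fun w => by simp)
    (fun f f' => eventualEnd_eq_of_eventually_eq htop hneg hτ fun w => by
      filter_upwards [eventually_eventualEnd_apply_eq htop hneg hτ f' w,
        eventually_eventualEnd_apply_eq htop hneg hτ f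
          ((eventualEnd htop hneg hτ f').1 w)] with i h' h
      simp only [LinearMap.coe_mk, AddHom.coe_mk, MulMemClass.coe_mul, Module.End.mul_apply,
        Pi.mul_apply, map_mul, ← h']
      exact h)

theorem mem_nullIdeal_iff [SetLike.GradedMonoid 𝒜] {f : cauchyAlgebra 𝒜} :
    f ∈ nullIdeal 𝒜 ↔ (f : ℕ → A) ∈ ⨆ m, nullSeqs 𝒜 m := by
  rw [nullIdeal, TwoSidedIdeal.mem_mk']
  rfl

/-- The action of the completed algebra `Ã` on `W` by pointwise eventual values. -/
def completionAction [SetLike.GradedMonoid 𝒜] (htop : ⨆ n, 𝒲 n = ⊤) (hneg : ∀ n < 0, 𝒲 n = ⊥)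
    (hτ : ∀ m, ∀ a ∈ 𝒜 m, τ a ∈ homogeneousEnd 𝒲 m) : GradedCompletion 𝒜 →ₐ[ℂ] glJ 𝒲 :=
  (nullIdeal 𝒜).ringCon.liftₐ (cauchyAction htop hneg hτ) fun x y h => by
    rw [TwoSidedIdeal.rel_iff] at h
    refine sub_eq_zero.1 ((map_sub (cauchyAction htop hneg hτ) x y).symm.trans
      (eventualEnd_eq_of_eventually_eq htop hneg hτ fun w => ?_))
    exact (eventually_apply_eq_zero_of_mem_nullSeqs htop hneg hτ (mem_nullIdeal_iff.1 h) w).mono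
      fun i hi => hi.symm

theorem completionAction_of [GradedAlgebra 𝒜] (htop : ⨆ n, 𝒲 n = ⊤)
    (hneg : ∀ n < 0, 𝒲 n = ⊥) (hτ : ∀ m, ∀ a ∈ 𝒜 m, τ a ∈ homogeneousEnd 𝒲 m) (a : A) :
    (completionAction htop hneg hτ (GradedCompletion.of 𝒜 a)).1 = τ a := by
  refine LinearMap.ext fun w => ?_
  obtain ⟨i, hi⟩ := (eventually_eventualEnd_apply_eq htop hneg hτ
    ⟨fun _ => a, const_mem_cauchyAlgebra 𝒜 a⟩ w).exists
  exact hi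

end GradedAction

/-! ### Density -/

section Density

variable {A : Type*} [Ring A] [Algebra ℂ A] {W : Type*} [AddCommGroup W] [Module ℂ W]
  {τ : A →ₐ[ℂ] Module.End ℂ W}

/-- Schur's lemma for an irreducible action containing an operator that has a nonzero
finite-dimensional eigenspace: the commutant preserves this eigenspace and therefore has an
eigenvector in it. -/
theorem exists_eq_smul_one_of_commute
    (hirr : ∀ U : Submodule ℂ W, (∀ a, ∀ w ∈ U, τ a w ∈ U) → U = ⊥ ∨ U = ⊤) (d : A) (μ : ℂ)
    [FiniteDimensional ℂ ((τ d).eigenspace μ)] (hne : (τ d).eigenspace μ ≠ ⊥)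
    (φ : Module.End ℂ W) (hφ : ∀ a, Commute φ (τ a)) : ∃ c : ℂ, φ = c • 1 := by
  have hmaps : ∀ w ∈ (τ d).eigenspace μ, φ w ∈ (τ d).eigenspace μ :=
    Module.End.mapsTo_genEigenspace_of_comm (hφ d).symm μ 1
  have := (Submodule.nontrivial_iff_ne_bot).2 hne
  obtain ⟨c, hc⟩ := Module.End.exists_eigenvalue (φ.restrict hmaps)
  obtain ⟨v, hv⟩ := hc.exists_hasEigenvector
  have hker : φ.eigenspace c = ⊥ ∨ φ.eigenspace c = ⊤ := hirr _ fun a w hw =>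
    Module.End.mapsTo_genEigenspace_of_comm (hφ a) c 1 hw
  refine ⟨c, LinearMap.ext fun w => ?_⟩
  rcases hker with h | h
  · refine absurd (Subtype.ext ?_) hv.2
    have hv' : (v : W) ∈ φ.eigenspace c :=
      Module.End.mem_eigenspace_iff.2 (congrArg Subtype.val hv.apply_eq_smul)
    rwa [h, Submodule.mem_bot] at hv'
  · exact Module.End.mem_eigenspace_iff.1 (h ▸ Submodule.mem_top)

/-- The density theorem for an irreducible action with scalar commutant. -/
theorem exists_forall_apply_eq [Nontrivial W]
    (hirr : ∀ U : Submodule ℂ W, (∀ a, ∀ w ∈ U, τ a w ∈ U) → U = ⊥ ∨ U = ⊤)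
    (hschur : ∀ φ : Module.End ℂ W, (∀ a, Commute φ (τ a)) → ∃ c : ℂ, φ = c • 1)
    (g : Module.End ℂ W) (s : Finset W) : ∃ a, ∀ w ∈ s, τ a w = g w := by
  have : IsSimpleModule τ.range W := by
    refine { exists_pair_ne := ⟨⊥, ⊤, bot_ne_top⟩, eq_bot_or_eq_top := fun U => ?_ }
    rcases hirr (U.restrictScalars ℂ) fun a w hw => U.smul_mem ⟨τ a, a, rfl⟩ hw with h | h
    · exact .inl ((Submodule.restrictScalars_eq_bot_iff ..).1 h)
    · exact .inr ((Submodule.restrictScalars_eq_top_iff ..).1 h)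
  have hcomm (φ : Module.End τ.range W) (w : W) : g (φ w) = φ (g w) := by
    obtain ⟨c, hc⟩ := hschur (φ.restrictScalars ℂ) fun a =>
      LinearMap.ext fun w => φ.map_smul ⟨τ a, a, rfl⟩ w
    have hc' (w : W) : φ w = c • w := LinearMap.congr_fun hc w
    rw [hc', hc', map_smul]
  obtain ⟨⟨_, a, rfl⟩, ha⟩ := jacobson_density (R := τ.range) (M := W)
    { toFun := g, map_add' := g.map_add, map_smul' := hcomm } s
  exact ⟨a, fun w hw => (ha w hw).symm⟩

variable {𝒜 : ℤ → Submodule ℂ A} [GradedAlgebra 𝒜] {𝒲 : ℤ → Submodule ℂ W}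

/-- Density for a graded action: an endomorphism of degree `m` on finitely many vectors of `W(n)`
is matched there by an element of `A_m`. -/
theorem exists_mem_forall_apply_eq (hind : iSupIndep 𝒲)
    (hτ : ∀ m, ∀ a ∈ 𝒜 m, τ a ∈ homogeneousEnd 𝒲 m)
    (hdens : ∀ (g : Module.End ℂ W) (s : Finset W), ∃ a, ∀ w ∈ s, τ a w = g w)
    (g : Module.End ℂ W) {s : Finset W} {m n : ℤ} (hs : ∀ w ∈ s, w ∈ 𝒲 n)
    (hg : ∀ w ∈ s, g w ∈ 𝒲 (n + m)) : ∃ a ∈ 𝒜 m, ∀ w ∈ s, τ a w = g w := by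
  classical
  obtain ⟨a, ha⟩ := hdens g s
  refine ⟨DirectSum.decompose 𝒜 a m, SetLike.coe_mem _, fun w hw => ?_⟩
  -- the component of degree `m` and the other components of `a` act on `w` in independent spaces
  have hsub : g w - τ (DirectSum.decompose 𝒜 a m) w ∈ ⨆ j ≠ n + m, 𝒲 j := by
    have hdec : τ (a - DirectSum.decompose 𝒜 a m) w ∈ ⨆ j ≠ n + m, 𝒲 j := by
      have h := DirectSum.sum_support_decompose 𝒜 a
      have h0 : a - DirectSum.decompose 𝒜 a m =
          ∑ i ∈ (DirectSum.decompose 𝒜 a).support.erase m, (DirectSum.decompose 𝒜 a i : A) := by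
        rw [sub_eq_iff_eq_add, add_comm]
        by_cases hm : m ∈ (DirectSum.decompose 𝒜 a).support
        · rw [Finset.add_sum_erase _ (fun i => (DirectSum.decompose 𝒜 a i : A)) hm, h]
        · rw [Finset.erase_eq_of_notMem hm, h, DFinsupp.notMem_support_iff.1 hm]
          simp
      rw [h0, map_sum, LinearMap.sum_apply]
      refine Submodule.sum_mem _ fun i hi => Submodule.mem_iSup_of_mem (n + i)
        (Submodule.mem_iSup_of_mem ?_ (hτ i _ (SetLike.coe_mem _) n w (hs w hw)))
      have := Finset.ne_of_mem_erase hi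
      omega
    rwa [map_sub, LinearMap.sub_apply, ha w hw] at hdec
  have hmem : g w - τ (DirectSum.decompose 𝒜 a m) w ∈ 𝒲 (n + m) :=
    sub_mem (hg w hw) (hτ m _ (SetLike.coe_mem _) n w (hs w hw))
  exact (sub_eq_zero.1 (Submodule.disjoint_def.1 (hind (n + m)) _ hmem hsub)).symm

/-- On `W(n)` every map `W(n) → W(n + m)` is a sum of composites `W(n) → W(0) → W(n + m)`, and
the two factors come from `A_{-n}` and `A_{m + n}`. -/
theorem exists_mem_mul_forall_apply_eq (hind : iSupIndep 𝒲) (hzero : 𝒲 0 ≠ ⊥)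
    (hτ : ∀ m, ∀ a ∈ 𝒜 m, τ a ∈ homogeneousEnd 𝒲 m)
    (hdens : ∀ (g : Module.End ℂ W) (s : Finset W), ∃ a, ∀ w ∈ s, τ a w = g w)
    (g : Module.End ℂ W) {m n : ℤ} [FiniteDimensional ℂ (𝒲 n)]
    (hg : ∀ w ∈ 𝒲 n, g w ∈ 𝒲 (n + m)) :
    ∃ b ∈ 𝒜 (m + n) * 𝒜 (-n), ∀ w ∈ 𝒲 n, τ b w = g w := by
  classical
  obtain ⟨w₀, hw₀, hne⟩ := Submodule.exists_mem_ne_zero_of_ne_bot hzero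
  have : Nontrivial W := ⟨⟨w₀, 0, hne⟩⟩
  let e := Module.finBasis ℂ (𝒲 n)
  have hq (j) : ∃ q ∈ 𝒜 (-n), ∀ i, τ q (e i) = e.coord j (e i) • w₀ := by
    obtain ⟨ψ, hψ⟩ := ((e.coord j).smulRight w₀).exists_extend
    have hψ' (i) : ψ (e i) = e.coord j (e i) • w₀ := LinearMap.congr_fun hψ (e i)
    obtain ⟨q, hq, h⟩ := exists_mem_forall_apply_eq hind hτ hdens ψ (m := -n) (n := n)
      (s := Finset.univ.image fun i => (e i : W)) (by simp)
      (by simpa [hψ'] using fun i => Submodule.smul_mem _ _ hw₀)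
    exact ⟨q, hq, fun i => (h _ (Finset.mem_image_of_mem _ (Finset.mem_univ i))).trans (hψ' i)⟩
  have hp (j) : ∃ p ∈ 𝒜 (m + n), τ p w₀ = g (e j) := by
    obtain ⟨ψ, hψ⟩ := isSimpleModule_iff_toSpanSingleton_surjective.1
      (inferInstance : IsSimpleModule (Module.End ℂ W) W) |>.2 w₀ hne (g (e j))
    have hψ' : ψ w₀ = g (e j) := hψ
    obtain ⟨p, hp, h⟩ := exists_mem_forall_apply_eq hind hτ hdens ψ (m := m + n) (n := 0)
      (s := {w₀}) (by simpa using hw₀) (by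
        simpa [hψ', add_comm] using hg _ (e j).2)
    exact ⟨p, hp, (h w₀ (by simp)).trans hψ'⟩
  choose q hq hq' using hq
  choose p hp hp' using hp
  refine ⟨∑ j, p j * q j, Submodule.sum_mem _ fun j _ => Submodule.mul_mem_mul (hp j) (hq j),
    fun w hw => ?_⟩
  have heq : τ (∑ j, p j * q j) ∘ₗ (𝒲 n).subtype = g ∘ₗ (𝒲 n).subtype := by
    refine e.ext fun i => ?_
    simp [hq', hp', Finsupp.single_apply, ite_smul, apply_ite]
  exact LinearMap.congr_fun heq ⟨w, hw⟩

/-- A homogeneous endomorphism is the pointwise eventual value of a Cauchy sequence. The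
correction that matches it on `W(N)` is taken in `A_{k + N} A_{-N}`: it kills the spaces `W(n)`
with `n < N`, already matched, and it keeps the sequence Cauchy. -/
theorem exists_mem_cauchySeqs_eventually_eq (hind : iSupIndep 𝒲) (htop : ⨆ n, 𝒲 n = ⊤)
    (hneg : ∀ n < 0, 𝒲 n = ⊥) (hzero : 𝒲 0 ≠ ⊥) (hfin : ∀ n, FiniteDimensional ℂ (𝒲 n))
    (hτ : ∀ m, ∀ a ∈ 𝒜 m, τ a ∈ homogeneousEnd 𝒲 m)
    (hdens : ∀ (g : Module.End ℂ W) (s : Finset W), ∃ a, ∀ w ∈ s, τ a w = g w)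
    {k : ℤ} {g : Module.End ℂ W} (hg : g ∈ homogeneousEnd 𝒲 k) :
    ∃ f ∈ cauchySeqs 𝒜 k, ∀ w, ∀ᶠ i in atTop, g w = τ (f i) w := by
  have hstep (N : ℕ) (a : 𝒜 k) : ∃ b : 𝒜 k, (b : A) - a ∈ 𝒜 (k + N) * 𝒜 (-N) ∧
      ∀ w ∈ 𝒲 N, τ b w = g w := by
    obtain ⟨c, hc, hcw⟩ := exists_mem_mul_forall_apply_eq hind hzero hτ hdens (g - τ a) (m := k)
      (n := N) fun w hw => sub_mem (hg _ w hw) (hτ k a a.2 _ w hw)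
    have hck : c ∈ 𝒜 k := by
      refine Submodule.mul_le.2 (fun x hx y hy => ?_) hc
      have h := SetLike.mul_mem_graded hx hy
      rwa [show k + N + -N = k by ring] at h
    exact ⟨⟨a + c, add_mem a.2 hck⟩, by simpa using hc, fun w hw => by simp [hcw w hw]⟩
  choose step hstep_sub hstep_apply using hstep
  let F : ℕ → 𝒜 k := fun N => Nat.rec (motive := fun _ => 𝒜 k) 0 step N
  have hFsub (N : ℕ) : (F (N + 1) : A) - (F N : A) ∈ 𝒜 (k + N) * 𝒜 (-N) := hstep_sub N (F N)
  have hFnhd {K : ℤ} {N : ℕ} (hN : K < N) : (F (N + 1) : A) - (F N : A) ∈ gradedNhd 𝒜 k K :=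
    Submodule.mem_iSup_of_mem (N : ℤ) (Submodule.mem_iSup_of_mem hN (hFsub N))
  have hFcauchy (K : ℤ) {r : ℕ} (hr : K < r) {i : ℕ} (hi : r ≤ i) :
      (F i : A) - (F r : A) ∈ gradedNhd 𝒜 k K := by
    induction i, hi using Nat.le_induction with
    | base => simp
    | succ i hi ih =>
      have h := add_mem (hFnhd (K := K) (N := i) (by omega)) ih
      rwa [sub_add_sub_cancel] at h
  refine ⟨fun i => F i, ⟨fun i => (F i).2, fun K => ⟨(K + 1).toNat, fun i hi j hj => ?_⟩⟩,
    fun w => ?_⟩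
  · have h := sub_mem (hFcauchy K (r := (K + 1).toNat) (by omega) hi)
      (hFcauchy K (r := (K + 1).toNat) (by omega) hj)
    rwa [sub_sub_sub_cancel_right] at h
  · have hw : w ∈ ⨆ n, 𝒲 n := htop ▸ Submodule.mem_top
    induction hw using Submodule.iSup_induction' with
    | mem n w hw =>
      rcases lt_or_ge n 0 with hn | hn
      · rw [hneg n hn, Submodule.mem_bot] at hw
        simp [hw]
      lift n to ℕ using hn
      refine eventually_atTop.2 ⟨n + 1, fun i hi => ?_⟩
      have h := apply_eq_zero_of_mem_gradedNhd hneg hτ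
        (hFcauchy n (r := n + 1) (by omega) hi) hw le_rfl
      rw [map_sub, LinearMap.sub_apply, sub_eq_zero] at h
      exact (h.trans (hstep_apply n (F n) w hw)).symm
    | zero => simp
    | add x y _ _ hx hy => filter_upwards [hx, hy] with i h h'; rw [map_add, map_add, h, h']

theorem cauchyAction_surjective (hind : iSupIndep 𝒲) (htop : ⨆ n, 𝒲 n = ⊤)
    (hneg : ∀ n < 0, 𝒲 n = ⊥) (hzero : 𝒲 0 ≠ ⊥) (hfin : ∀ n, FiniteDimensional ℂ (𝒲 n))
    (hτ : ∀ m, ∀ a ∈ 𝒜 m, τ a ∈ homogeneousEnd 𝒲 m)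
    (hdens : ∀ (g : Module.End ℂ W) (s : Finset W), ∃ a, ∀ w ∈ s, τ a w = g w) :
    Function.Surjective (cauchyAction (𝒜 := 𝒜) htop hneg hτ) := by
  rintro ⟨g, hg⟩
  suffices h : ∃ f ∈ ⨆ m, cauchySeqs 𝒜 m, ∀ w, ∀ᶠ i in atTop, g w = τ (f i) w by
    obtain ⟨f, hf, h⟩ := h
    exact ⟨⟨f, hf⟩, eventualEnd_eq_of_eventually_eq htop hneg hτ h⟩
  change g ∈ ⨆ k, homogeneousEnd 𝒲 k at hg
  induction hg using Submodule.iSup_induction' with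
  | mem k g hg =>
    obtain ⟨f, hf, h⟩ :=
      exists_mem_cauchySeqs_eventually_eq hind htop hneg hzero hfin hτ hdens hg
    exact ⟨f, Submodule.mem_iSup_of_mem k hf, h⟩
  | zero => exact ⟨0, zero_mem _, by simp⟩
  | add g g' _ _ hg hg' =>
    obtain ⟨f, hf, h⟩ := hg
    obtain ⟨f', hf', h'⟩ := hg'
    refine ⟨f + f', add_mem hf hf', fun w => ?_⟩
    filter_upwards [h w, h' w] with i hi hi'
    rw [LinearMap.add_apply, hi, hi', Pi.add_apply, map_add, LinearMap.add_apply]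

end Density

/-! ### Weights of modules -/

/-- The field property: `u_n w = 0` for `n` large. -/
theorem exists_vertexMode_apply_eq_zero {V W : Type*} [AddCommGroup V] [Module ℂ V]
    [AddCommGroup W] [Module ℂ W] (Y : V →ₗ[ℂ] VertexOperator ℂ W) (u : V) (w : W) (b : ℤ) :
    ∃ N : ℕ, ∀ i : ℕ, N ≤ i → vertexMode Y u (b + i) w = 0 := by
  let o := HahnSeries.order ((HahnModule.of ℂ).symm (Y u w))
  exact ⟨(-o - b).toNat, fun i hi =>
    VertexOperator.ncoeff_eq_zero_of_lt_order _ _ _ (by change -(b + i) - 1 < o; omega)⟩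

namespace VertexOperatorAlgebra

variable {V : Type*} [AddCommGroup V] [Module ℂ V] {𝒱 : VertexOperatorAlgebra V}
  {W : Type*} [AddCommGroup W] [Module ℂ W] (M : 𝒱.Mod W)

/-- The Jacobi identity for `ω` and `v` at `l = 0`, `m = 1` is the commutator of `L(0)` with
`v_n`, and the `L(-1)`-derivative property evaluates it. -/
theorem Mod.conf_one_vertexMode {p : ℤ} {v : V} (hv : v ∈ 𝒱.wt p) (n : ℤ) (w : W) :
    vertexMode M.Y 𝒱.conf 1 (vertexMode M.Y v n w) =
      vertexMode M.Y v n (vertexMode M.Y 𝒱.conf 1 w) +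
        ((p - n - 1 : ℤ) : ℂ) • vertexMode M.Y v n w := by
  have h := M.jacobi 𝒱.conf v 0 1 n w
  have h₁ : (∑ᶠ i : ℕ, ((i : ℤ).negOnePow * Ring.choose (0 : ℤ) i : ℤ) •
      vertexMode M.Y 𝒱.conf (1 + 0 - i) (vertexMode M.Y v (n + i) w)) =
      vertexMode M.Y 𝒱.conf 1 (vertexMode M.Y v n w) := by
    rw [finsum_eq_single _ 0 fun i hi => by simp [Ring.choose_zero_pos ℤ (Nat.pos_of_ne_zero hi)]]
    simp
  have h₂ : (∑ᶠ i : ℕ, ((0 + i : ℤ).negOnePow * Ring.choose (0 : ℤ) i : ℤ) •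
      vertexMode M.Y v (n + 0 - i) (vertexMode M.Y 𝒱.conf (1 + i) w)) =
      vertexMode M.Y v n (vertexMode M.Y 𝒱.conf 1 w) := by
    rw [finsum_eq_single _ 0 fun i hi => by simp [Ring.choose_zero_pos ℤ (Nat.pos_of_ne_zero hi)]]
    simp
  have h₃ : (∑ᶠ i : ℕ, Ring.choose (1 : ℤ) i •
      vertexMode M.Y (vertexMode 𝒱.Y 𝒱.conf (0 + i) v) (1 + n - i) w) =
      ((p - n - 1 : ℤ) : ℂ) • vertexMode M.Y v n w := by
    have hc (i : ℕ) : Ring.choose (1 : ℤ) i = (Nat.choose 1 i : ℤ) := by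
      exact_mod_cast Ring.choose_natCast (R := ℤ) 1 i
    rw [finsum_eq_sum_of_support_subset (s := Finset.range 2)]
    · rw [Finset.sum_range_succ, Finset.sum_range_one, hc, hc]
      simp only [Nat.cast_zero, Nat.cast_one, zero_add, add_zero, sub_zero, Nat.choose_zero_right,
        Nat.choose_self, one_smul]
      rw [M.derivative, 𝒱.weight p v hv, show (1 + n - 1 : ℤ) = n by ring]
      simp only [vertexMode, map_smul, Pi.smul_apply, LinearMap.smul_apply]
      rw [← add_smul]
      congr 1
      push_cast
      ring
    · intro i hi
      by_contra hi'
      have : 1 < i := by simpa using hi'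
      exact hi (by simp [hc, Nat.choose_eq_zero_of_lt this])
  rw [h₁, h₂, h₃, sub_eq_iff_eq_add] at h
  rw [h, add_comm]

theorem Mod.iSupIndep_wt : iSupIndep M.wt :=
  M.isInternal_wt.submodule_iSupIndep

theorem Mod.iSup_wt : ⨆ h, M.wt h = ⊤ :=
  M.isInternal_wt.submodule_iSup_eq_top

/-- The weight spaces are the full eigenspaces of `L(0)`. -/
theorem Mod.wt_eq_eigenspace (h : ℂ) :
    M.wt h = (vertexMode M.Y 𝒱.conf 1).eigenspace h := by
  have hle (μ : ℂ) : M.wt μ ≤ (vertexMode M.Y 𝒱.conf 1).eigenspace μ := fun w hw =>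
    Module.End.mem_eigenspace_iff.2 (M.weight μ w hw)
  refine le_antisymm (hle h) fun w hw => ?_
  -- the component of `w` outside `W_h` has eigenvalue `h` too, but lies in the sum of the other
  -- eigenspaces
  have htop : w ∈ M.wt h ⊔ ⨆ μ ≠ h, M.wt μ := by
    have : (⊤ : Submodule ℂ W) ≤ M.wt h ⊔ ⨆ μ ≠ h, M.wt μ := by
      rw [← M.iSup_wt]
      refine iSup_le fun μ => ?_
      by_cases hμ : μ = h
      · exact hμ ▸ le_sup_left
      · exact le_sup_of_le_right (le_iSup₂_of_le μ hμ le_rfl)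
    exact this trivial
  obtain ⟨x, hx, y, hy, rfl⟩ := Submodule.mem_sup.1 htop
  have hy' : y ∈ (vertexMode M.Y 𝒱.conf 1).eigenspace h := by
    simpa using sub_mem hw (hle h hx)
  have hy0 : y = 0 := Submodule.disjoint_def.1 (Module.End.eigenspaces_iSupIndep _ h) y hy'
    (iSup₂_mono (fun μ _ => hle μ) hy)
  simpa [hy0] using hx

theorem Mod.vertexMode_mem_wt {p : ℤ} {v : V} (hv : v ∈ 𝒱.wt p) (n : ℤ) {h : ℂ} {w : W}
    (hw : w ∈ M.wt h) : vertexMode M.Y v n w ∈ M.wt (h + (p - n - 1 : ℤ)) := by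
  rw [M.wt_eq_eigenspace, Module.End.mem_eigenspace_iff, M.conf_one_vertexMode hv,
    M.weight h w hw, map_smul, add_smul]

theorem Mod.exists_isLowestWeight (hM : M.IsIrreducible) : ∃ h, M.IsLowestWeight h := by
  obtain ⟨hnt, hirr⟩ := hM
  obtain ⟨μ, hμ⟩ : ∃ μ, M.wt μ ≠ ⊥ := by
    by_contra! hbot
    have := M.iSup_wt
    simp only [hbot, iSup_bot] at this
    exact bot_ne_top this
  -- the weight spaces in one coset of `ℤ` span a submodule
  have htop : ⨆ n : ℤ, M.wt (μ + n) = ⊤ := by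
    refine (hirr (⨆ n : ℤ, M.wt (μ + n)) fun v n w hw => ?_).resolve_left fun hbot => ?_
    · have hv : v ∈ ⨆ p, 𝒱.wt p := 𝒱.isInternal_wt.submodule_iSup_eq_top ▸ Submodule.mem_top
      induction hv using Submodule.iSup_induction' with
      | mem p v hv =>
        induction hw using Submodule.iSup_induction' with
        | mem j w hw =>
          have h := M.vertexMode_mem_wt hv n hw
          rw [add_assoc, ← Int.cast_add] at h
          exact Submodule.mem_iSup_of_mem _ h
        | zero => simp
        | add x y _ _ hx hy => rw [map_add]; exact add_mem hx hy
      | zero => simp [vertexMode]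
      | add x y _ _ hx hy =>
        simp only [vertexMode, map_add, Pi.add_apply, LinearMap.add_apply] at hx hy ⊢
        exact add_mem hx hy
    · exact hμ (eq_bot_iff.2 (hbot ▸ le_iSup_of_le (0 : ℤ) (by simp)))
  have hmem (ν : ℂ) (hν : M.wt ν ≠ ⊥) : ∃ n : ℤ, ν = μ + n := by
    by_contra! hne
    refine hν (disjoint_self.1 ((M.iSupIndep_wt ν).mono_right ?_))
    have : (⊤ : Submodule ℂ W) ≤ ⨆ j ≠ ν, M.wt j :=
      htop ▸ iSup_le fun n => le_iSup₂_of_le (μ + n) (hne n).symm le_rfl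
    exact le_top.trans this
  obtain ⟨N, hN⟩ := M.wt_eq_bot μ
  obtain ⟨n₀, hn₀, hmin⟩ := Int.exists_least_of_bdd (P := fun n : ℤ => M.wt (μ + n) ≠ ⊥)
    ⟨N, fun n hn => not_lt.1 fun hlt => hn (hN n hlt)⟩ ⟨0, by simpa using hμ⟩
  refine ⟨μ + n₀, hn₀, fun ν hν => ?_⟩
  obtain ⟨n, rfl⟩ := hmem ν hν
  obtain ⟨j, hj⟩ := Int.le.dest (hmin n hν)
  exact ⟨j, by rw [← hj]; push_cast; ring⟩

/-! ### The grading by lowest weight -/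

variable {M} {h : ℂ}

theorem Mod.iSupIndep_shiftedWt (M : 𝒱.Mod W) (h : ℂ) : iSupIndep (M.shiftedWt h) :=
  M.iSupIndep_wt.comp (f := fun n : ℤ => h + n) fun _ _ hab =>
    Int.cast_injective (add_left_cancel hab)

theorem Mod.IsLowestWeight.iSup_shiftedWt (hh : M.IsLowestWeight h) :
    ⨆ n, M.shiftedWt h n = ⊤ := by
  refine eq_top_iff.2 (M.iSup_wt ▸ iSup_le fun μ => ?_)
  by_cases hμ : M.wt μ = ⊥
  · exact hμ ▸ bot_le
  · obtain ⟨n, rfl⟩ := hh.2 μ hμ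
    exact le_iSup_of_le (n : ℤ) (by simp [shiftedWt])

theorem Mod.IsLowestWeight.shiftedWt_eq_bot (hh : M.IsLowestWeight h) (n : ℤ) (hn : n < 0) :
    M.shiftedWt h n = ⊥ := by
  by_contra hne
  obtain ⟨j, hj⟩ := hh.2 _ hne
  have : n = j := by exact_mod_cast add_left_cancel hj
  omega

variable (M) in
theorem Mod.freeAction_mem_homogeneousEnd (h : ℂ) (m : ℤ) (a : ModeAlgebra V)
    (ha : a ∈ 𝒱.modeGrading m) : M.freeAction a ∈ homogeneousEnd (M.shiftedWt h) m := by
  refine (Submodule.span_le (p := (homogeneousEnd (M.shiftedWt h) m).comap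
    M.freeAction.toLinearMap)).2 (fun x hx => ?_) ha
  clear ha
  change M.freeAction x ∈ homogeneousEnd (M.shiftedWt h) m
  induction hx with
  | one => intro n w hw; simpa using hw
  | gen_mul n hv hx ih =>
    rw [map_mul, M.freeAction_gen]
    refine homogeneousEnd_mul_mem (fun j w hw => ?_) ih
    have h' := M.vertexMode_mem_wt hv n hw
    rwa [add_assoc, ← Int.cast_add] at h'

theorem Mod.IsIrreducible.eq_bot_or_eq_top (hM : M.IsIrreducible) (U : Submodule ℂ W)
    (hU : ∀ a, ∀ w ∈ U, M.freeAction a w ∈ U) : U = ⊥ ∨ U = ⊤ :=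
  hM.2 U fun v n w hw => M.freeAction_gen v n ▸ hU (gen v n) w hw

/-- The free algebra acts densely on an irreducible module: Schur's lemma applies because `L(0)`
acts with finite-dimensional eigenspaces. -/
theorem Mod.IsIrreducible.exists_freeAction_apply_eq (hM : M.IsIrreducible)
    (g : Module.End ℂ W) (s : Finset W) : ∃ a, ∀ w ∈ s, M.freeAction a w = g w := by
  have := hM.1
  obtain ⟨h, hh⟩ := M.exists_isLowestWeight hM
  have heq : M.wt h = (M.freeAction (gen 𝒱.conf 1)).eigenspace h := by
    rw [M.freeAction_gen, M.wt_eq_eigenspace]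
  have : FiniteDimensional ℂ ((M.freeAction (gen 𝒱.conf 1)).eigenspace h) :=
    heq ▸ M.finiteDimensional_wt h
  exact exists_forall_apply_eq hM.eq_bot_or_eq_top
    (exists_eq_smul_one_of_commute hM.eq_bot_or_eq_top (gen 𝒱.conf 1) h (heq ▸ hh.1)) g s

/-! ### The action of the universal enveloping algebra -/

variable (M) in
/-- The partial sums of a mode series act on each vector as the full, finite, sum from some
point on. -/
theorem Mod.eventually_freeAction_modeSeries (c : ℕ → ℤ) (u v : V) (a b : ℤ) (w : W) :
    ∀ᶠ N in atTop, M.freeAction (modeSeries c u v a b N) w =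
      ∑ᶠ i : ℕ, c i • vertexMode M.Y u (a - i) (vertexMode M.Y v (b + i) w) := by
  obtain ⟨r, hr⟩ := exists_vertexMode_apply_eq_zero M.Y v w b
  refine eventually_atTop.2 ⟨r, fun N hN => ?_⟩
  rw [finsum_eq_sum_of_support_subset (s := Finset.range N)]
  · simp [modeSeries, M.freeAction_gen]
  · intro i hi
    by_contra hi'
    have : N ≤ i := by simpa using hi'
    exact hi (by simp [hr i (hN.trans this)])

/-- The action of the completed free algebra on a module with a lowest weight. -/
def Mod.IsLowestWeight.completedAction (hh : M.IsLowestWeight h) :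
    GradedCompletion 𝒱.modeGrading →ₐ[ℂ] glJ (M.shiftedWt h) :=
  completionAction hh.iSup_shiftedWt hh.shiftedWt_eq_bot (M.freeAction_mem_homogeneousEnd h)

theorem Mod.IsLowestWeight.completedAction_cgen (hh : M.IsLowestWeight h) (v : V) (n : ℤ) :
    (hh.completedAction (𝒱.cgen v n)).1 = vertexMode M.Y v n :=
  (completionAction_of _ _ _ _).trans (M.freeAction_gen v n)

theorem Mod.IsLowestWeight.eventually_completedAction_mk (hh : M.IsLowestWeight h)
    (f : cauchyAlgebra 𝒱.modeGrading) (w : W) :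
    ∀ᶠ i in atTop, (hh.completedAction (GradedCompletion.mk 𝒱.modeGrading f)).1 w =
      M.freeAction (f.1 i) w :=
  eventually_eventualEnd_apply_eq hh.iSup_shiftedWt hh.shiftedWt_eq_bot
    (M.freeAction_mem_homogeneousEnd h) f w

theorem Mod.IsLowestWeight.completedAction_modeSum (hh : M.IsLowestWeight h) (c : ℕ → ℤ)
    (u v : V) (a b : ℤ) (w : W) : (hh.completedAction (𝒱.modeSum c u v a b)).1 w =
      ∑ᶠ i : ℕ, c i • vertexMode M.Y u (a - i) (vertexMode M.Y v (b + i) w) := by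
  obtain ⟨N, h₁, h₂⟩ := ((hh.eventually_completedAction_mk _ w).and
    (M.eventually_freeAction_modeSeries c u v a b w)).exists
  exact h₁.trans h₂

theorem Mod.IsLowestWeight.completedAction_eq_zero (hh : M.IsLowestWeight h)
    {x : GradedCompletion 𝒱.modeGrading} (hx : 𝒱.JacRelator x) : hh.completedAction x = 0 := by
  refine Subtype.ext ?_
  induction hx with
  | vac n =>
    rw [map_sub, AddSubgroupClass.coe_sub, completedAction_cgen, M.vertexMode_vac]
    split_ifs <;> simp
  | derivative u n =>
    rw [map_sub, map_smul, AddSubgroupClass.coe_sub, SetLike.val_smul, completedAction_cgen,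
      completedAction_cgen, M.derivative, sub_self]
    rfl
  | jacobi u v l m n =>
    refine LinearMap.ext fun w => ?_
    -- the support of the last sum is finite, so that the sum commutes with homomorphisms
    have hfin : (Function.support fun i : ℕ =>
        Ring.choose m i • 𝒱.cgen (vertexMode 𝒱.Y u (l + i) v) (m + n - i)).Finite := by
      obtain ⟨r, hr⟩ := exists_vertexMode_apply_eq_zero 𝒱.Y u v l
      refine (Set.finite_Iio r).subset fun i hi => Set.mem_Iio.2 (not_le.1 fun hri => hi ?_)
      simp [hr i hri, cgen, gen]
    have hsum : (hh.completedAction (∑ᶠ i : ℕ,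
        Ring.choose m i • 𝒱.cgen (vertexMode 𝒱.Y u (l + i) v) (m + n - i))).1 w =
        ∑ᶠ i : ℕ, Ring.choose m i •
          vertexMode M.Y (vertexMode 𝒱.Y u (l + i) v) (m + n - i) w := by
      let ev : GradedCompletion 𝒱.modeGrading →+ W :=
        ((LinearMap.applyₗ w : Module.End ℂ W →ₗ[ℂ] W) ∘ₗ
          ((glJ (M.shiftedWt h)).val.comp hh.completedAction).toLinearMap).toAddMonoidHom
      refine (AddMonoidHom.map_finsum ev hfin).trans (finsum_congr fun i => ?_)
      rw [map_zsmul]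
      exact congrArg _ (LinearMap.congr_fun (hh.completedAction_cgen _ _) w)
    rw [map_sub, map_sub, AddSubgroupClass.coe_sub, AddSubgroupClass.coe_sub,
      LinearMap.sub_apply, LinearMap.sub_apply, hsum, completedAction_modeSum,
      completedAction_modeSum]
    exact sub_eq_zero.2 (M.jacobi u v l m n w)

/-- The natural action of `U(V)` on a module with a lowest weight. -/
def Mod.IsLowestWeight.univEnvAction (hh : M.IsLowestWeight h) :
    𝒱.UnivEnv →ₐ[ℂ] glJ (M.shiftedWt h) :=
  𝒱.jacIdeal.ringCon.liftₐ hh.completedAction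
    (TwoSidedIdeal.ringCon_le_iff.1 (TwoSidedIdeal.span_le.2 fun _ hx =>
      (TwoSidedIdeal.mem_ker _).2 (hh.completedAction_eq_zero hx)))

theorem UnivEnv.mk_surjective : Function.Surjective (UnivEnv.mk 𝒱) :=
  (RingCon.mkₐ_surjective (α := ℂ) 𝒱.jacIdeal.ringCon).comp
    (RingCon.mkₐ_surjective (α := ℂ) (nullIdeal 𝒱.modeGrading).ringCon)

end VertexOperatorAlgebra

end

theorem mainTheorem8 {V : Type*} [AddCommGroup V] [Module ℂ V] (𝒱 : VertexOperatorAlgebra V)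
    {W : Type*} [AddCommGroup W] [Module ℂ W] (M : 𝒱.Mod W) (hM : M.IsIrreducible) :
    ∃ h : ℂ, M.IsLowestWeight h ∧
      ∃ ρ : 𝒱.UnivEnv →ₐ[ℂ] glJ (M.shiftedWt h),
        M.IsNaturalAction ((glJ (M.shiftedWt h)).val.comp ρ) ∧
        (∀ ρ' : 𝒱.UnivEnv →ₐ[ℂ] Module.End ℂ W, M.IsNaturalAction ρ' →
          ρ' = (glJ (M.shiftedWt h)).val.comp ρ) ∧
        Function.Surjective ρ := by
  obtain ⟨h, hh⟩ := M.exists_isLowestWeight hM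
  have hnat : M.IsNaturalAction ((glJ (M.shiftedWt h)).val.comp hh.univEnvAction) :=
    hh.eventually_completedAction_mk
  refine ⟨h, hh, hh.univEnvAction, hnat, fun ρ' hρ' => ?_, fun g => ?_⟩
  · refine AlgHom.ext fun x => LinearMap.ext fun w => ?_
    obtain ⟨f, rfl⟩ := VertexOperatorAlgebra.UnivEnv.mk_surjective x
    obtain ⟨i, h₁, h₂⟩ := ((hρ' f w).and (hnat f w)).exists
    exact h₁.trans h₂.symm
  · have hzero : M.shiftedWt h 0 ≠ ⊥ := by simpa [VertexOperatorAlgebra.Mod.shiftedWt] using hh.1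
    obtain ⟨f, hf⟩ := cauchyAction_surjective (M.iSupIndep_shiftedWt h) hh.iSup_shiftedWt
      hh.shiftedWt_eq_bot hzero (fun _ => M.finiteDimensional_wt _)
      (M.freeAction_mem_homogeneousEnd h) hM.exists_freeAction_apply_eq g
    exact ⟨VertexOperatorAlgebra.UnivEnv.mk 𝒱 f, hf⟩
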